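/- Let $X$ be a real or complex Banach space. Suppose that $X$ is $M$-embedded, i.e. the annihilator $X^{\perp}\subset X^{***}$ of the canonical image of $X$ in $X^{**}$ is the kernel of an $L$-projection on $X^{***}$ (a bounded linear idempotent $P$ with $\|\varphi\|=\|P\varphi\|+\|\varphi-P\varphi\|$ for every $\varphi\in X^{***}$). Suppose also that $X$ has a monotone Schauder basis, i.e. a Schauder basis $(e_n)_{n\in\mathbb N}$ with coordinate functionals $(e_n^*)_{n\in\mathbb N}$ whose partial sum projections $P_n x=\sum_{i<n}e_i^*(x)e_i$ all satisfy $\|P_n\|\le 1$. Then $X$ has property $\mathrm{A}^{k}$: for every Banach space $Z$ over the same scalar field, the set of compact linear operators $T:X\to Z$ that attain their norm (i.e. $\|Tx\|=\|T\|$ for some $x\in X$ with $\|x\|=1$) is dense, in the operator norm, in the space of all compact linear operators from $X$ to $Z$. -/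

import Mathlib

universe w u v

/-- A bounded linear operator attains its norm if `‖T x‖ = ‖T‖` for some unit vector `x`. -/
def AttainsNorm {𝕜 : Type*} [RCLike 𝕜] {X : Type*} [NormedAddCommGroup X] [NormedSpace 𝕜 X]
    {Z : Type*} [NormedAddCommGroup Z] [NormedSpace 𝕜 Z] (T : X →L[𝕜] Z) : Prop :=
  ∃ x : X, ‖x‖ = 1 ∧ ‖T x‖ = ‖T‖

/-- Property A^k: for every Banach space `Z` over `𝕜`, the compact norm attaining operators
from `X` to `Z` are dense, for the operator norm, in the compact operators from `X` to `Z`. -/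
def PropertyAk (𝕜 : Type w) [RCLike 𝕜] (X : Type u) [NormedAddCommGroup X]
    [NormedSpace 𝕜 X] : Prop :=
  ∀ (Z : Type v) [NormedAddCommGroup Z] [NormedSpace 𝕜 Z] [CompleteSpace Z],
    {T : X →L[𝕜] Z | IsCompactOperator T} ⊆
      closure {T : X →L[𝕜] Z | IsCompactOperator T ∧ AttainsNorm T}

/-- A subspace `J` of `E` is an M-ideal if its annihilator in the dual of `E` is the kernel of an
L-projection on the dual of `E`. -/
def IsMIdeal {𝕜 : Type*} [RCLike 𝕜] {E : Type*} [NormedAddCommGroup E] [NormedSpace 𝕜 E]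
    (J : Submodule 𝕜 E) : Prop :=
  ∃ P : StrongDual 𝕜 E →L[𝕜] StrongDual 𝕜 E,
    IsLprojection (StrongDual 𝕜 E) P ∧
      ∀ φ : StrongDual 𝕜 E, P φ = 0 ↔ ∀ x ∈ J, φ x = 0

/-- `X` is M-embedded: the annihilator, in the third dual, of the canonical image of `X` in its
bidual is the kernel of an L-projection on the third dual. -/
def IsMEmbedded (𝕜 : Type*) [RCLike 𝕜] (X : Type*) [NormedAddCommGroup X]
    [NormedSpace 𝕜 X] : Prop :=
  IsMIdeal (𝕜 := 𝕜) (E := StrongDual 𝕜 (StrongDual 𝕜 X))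
    (NormedSpace.inclusionInDoubleDual 𝕜 X).range

/-- A Schauder basis is monotone if its basis projections (the partial sum operators) are
contractive. -/
def IsMonotoneBasis {𝕜 : Type*} [RCLike 𝕜] {X : Type*} [NormedAddCommGroup X]
    [NormedSpace 𝕜 X] (b : SchauderBasis 𝕜 X) : Prop :=
  ∀ n : ℕ, ‖b.proj n‖ ≤ 1

open Filter Topology

set_option maxSynthPendingDepth 3

section MEmbedded

variable {𝕜 : Type*} [RCLike 𝕜] {X : Type*} [NormedAddCommGroup X] [NormedSpace 𝕜 X]

/-- In an M-embedded space, a functional on the bidual which extends `f` without increasing the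
norm is evaluation at `f`. -/
theorem IsMEmbedded.eq_inclusionInDoubleDual (hM : IsMEmbedded 𝕜 X) (f : StrongDual 𝕜 X)
    (φ : StrongDual 𝕜 (StrongDual 𝕜 (StrongDual 𝕜 X)))
    (hφ : ∀ x, φ (NormedSpace.inclusionInDoubleDual 𝕜 X x) = f x) (hle : ‖φ‖ ≤ ‖f‖) :
    φ = NormedSpace.inclusionInDoubleDual 𝕜 (StrongDual 𝕜 X) f := by
  obtain ⟨P, hP, hker⟩ := hM
  have hproj : ∀ ψ, P (P ψ) = P ψ := fun ψ => congrArg (fun A => A ψ) hP.proj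
  have hfix : ∀ ψ : StrongDual 𝕜 (StrongDual 𝕜 (StrongDual 𝕜 X)),
      (∀ x, ψ (NormedSpace.inclusionInDoubleDual 𝕜 X x) = f x) → ‖ψ‖ ≤ ‖f‖ → P ψ = ψ := by
    intro ψ hψ hψle
    have hres : ∀ x, P ψ (NormedSpace.inclusionInDoubleDual 𝕜 X x) = f x := by
      intro x
      have h := (hker (ψ - P ψ)).1 (by rw [map_sub, hproj, sub_self])
        (NormedSpace.inclusionInDoubleDual 𝕜 X x) ⟨x, rfl⟩
      rw [_root_.sub_apply, sub_eq_zero] at h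
      rw [← h, hψ]
    have hnorm : ‖f‖ ≤ ‖P ψ‖ := by
      refine f.opNorm_le_bound (norm_nonneg _) fun x => ?_
      rw [← hres x]
      refine ((P ψ).le_opNorm _).trans ?_
      gcongr
      exact NormedSpace.double_dual_bound 𝕜 X x
    have hL : ‖ψ‖ = ‖P ψ‖ + ‖ψ - P ψ‖ := hP.Lnorm ψ
    have h0 : ‖ψ - P ψ‖ = 0 := le_antisymm (by linarith) (norm_nonneg _)
    exact (sub_eq_zero.1 (norm_eq_zero.1 h0)).symm
  rw [← hfix φ hφ hle, ← hfix (NormedSpace.inclusionInDoubleDual 𝕜 (StrongDual 𝕜 X) f)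
    (fun x => rfl) (NormedSpace.double_dual_bound 𝕜 _ f), ← sub_eq_zero, ← map_sub, hker]
  rintro _ ⟨x, rfl⟩
  exact sub_eq_zero.2 (hφ x)

/-- The dual of an M-embedded space has no proper closed norming subspaces. -/
theorem IsMEmbedded.eq_top_of_norming (hM : IsMEmbedded 𝕜 X) (V : Submodule 𝕜 (StrongDual 𝕜 X))
    (hV : IsClosed (V : Set (StrongDual 𝕜 X)))
    (hnorming : ∀ (x : X) (C : ℝ), 0 ≤ C → (∀ f ∈ V, ‖f x‖ ≤ C * ‖f‖) → ‖x‖ ≤ C) : V = ⊤ := by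
  have hann : ∀ ψ : StrongDual 𝕜 (StrongDual 𝕜 X), (∀ f ∈ V, ψ f = 0) → ψ = 0 := by
    intro ψ hψ
    ext f
    let R : StrongDual 𝕜 (StrongDual 𝕜 X) →L[𝕜] StrongDual 𝕜 V :=
      (ContinuousLinearMap.compL 𝕜 V (StrongDual 𝕜 X) 𝕜).flip V.subtypeL
    have hRle : ∀ χ : StrongDual 𝕜 (StrongDual 𝕜 X), ‖R χ‖ ≤ ‖χ‖ := fun χ =>
      (R χ).opNorm_le_bound (norm_nonneg _) fun g => χ.le_opNorm _
    let j : X →ₗᵢ[𝕜] StrongDual 𝕜 V :=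
      { toLinearMap := (R ∘L NormedSpace.inclusionInDoubleDual 𝕜 X).toLinearMap
        norm_map' := fun x => by
          refine le_antisymm ((hRle _).trans (NormedSpace.double_dual_bound 𝕜 X x)) ?_
          refine hnorming x _ (norm_nonneg _) fun g hg => ?_
          exact (R (NormedSpace.inclusionInDoubleDual 𝕜 X x)).le_opNorm ⟨g, hg⟩ }
    let e := j.equivRange
    obtain ⟨Φ, hΦ, hΦnorm⟩ := exists_extension_norm_eq (LinearMap.range j.toLinearMap)
      (f ∘L (e.symm.toContinuousLinearEquiv : _ →L[𝕜] X))
    have hΦle : ‖Φ‖ ≤ ‖f‖ := by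
      rw [hΦnorm]
      refine ContinuousLinearMap.opNorm_le_bound _ (norm_nonneg _) fun y => ?_
      exact (f.le_opNorm _).trans_eq (by congr 1; exact e.symm.norm_map y)
    have hΦj : ∀ x, Φ (j x) = f x := fun x => by
      refine (hΦ (e x)).trans ?_
      exact congrArg f (e.symm_apply_apply x)
    have key := hM.eq_inclusionInDoubleDual f (Φ ∘L R) hΦj
      (ContinuousLinearMap.opNorm_le_bound _ (norm_nonneg _) fun χ =>
        (Φ.le_opNorm _).trans (mul_le_mul hΦle (hRle χ) (norm_nonneg _) (norm_nonneg _)))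
    have hRψ : R ψ = 0 := by
      ext g
      exact hψ g g.2
    have h := congrArg (fun A => A ψ) key
    simp only [ContinuousLinearMap.comp_apply, hRψ, map_zero, NormedSpace.dual_def] at h
    exact h.symm
  have := hV
  refine Submodule.eq_top_iff'.2 fun f => ?_
  by_contra hf
  have hne : ‖V.mkQ f‖ ≠ 0 := by
    refine norm_ne_zero_iff.2 ?_
    simpa using hf
  obtain ⟨g, -, hg⟩ := exists_dual_vector 𝕜 (V.mkQ f) hne
  have h := hann (g ∘L V.mkQL) fun f' hf' => by
    have : V.mkQL f' = 0 := (Submodule.Quotient.mk_eq_zero V).2 hf'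
    rw [ContinuousLinearMap.comp_apply, this, map_zero]
  have h' : g (V.mkQ f) = 0 := congrArg (fun A => A f) h
  rw [hg] at h'
  exact hne (by exact_mod_cast h')

/-- A monotone basis of an M-embedded space is shrinking. -/
theorem IsMEmbedded.tendsto_comp_proj (hM : IsMEmbedded 𝕜 X) {b : SchauderBasis 𝕜 X}
    (hb : IsMonotoneBasis b) (f : StrongDual 𝕜 X) :
    Tendsto (fun n => f ∘L b.proj n) atTop (𝓝 f) := by
  let V : Submodule 𝕜 (StrongDual 𝕜 X) :=
    { carrier := {f | Tendsto (fun n => f ∘L b.proj n) atTop (𝓝 f)}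
      add_mem' := fun {f g} hf hg => by
        simpa only [Set.mem_ofPred_eq, ContinuousLinearMap.add_comp] using Tendsto.add hf hg
      zero_mem' := by simp
      smul_mem' := fun c f hf => by
        simpa only [Set.mem_ofPred_eq, ContinuousLinearMap.smul_comp] using
          Tendsto.const_smul hf c }
  have hle : ∀ (g : StrongDual 𝕜 X) (n : ℕ), ‖g ∘L b.proj n‖ ≤ ‖g‖ := fun g n =>
    (ContinuousLinearMap.opNorm_comp_le _ _).trans
      (mul_le_of_le_one_right (norm_nonneg _) (hb n))
  have hclosed : IsClosed (V : Set (StrongDual 𝕜 X)) := by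
    refine isClosed_of_closure_subset fun f hf => ?_
    refine Metric.tendsto_atTop.2 fun ε hε => ?_
    obtain ⟨g, hg, hfg⟩ := Metric.mem_closure_iff.1 hf (ε / 3) (by positivity)
    obtain ⟨N, hN⟩ := Metric.tendsto_atTop.1 hg (ε / 3) (by positivity)
    refine ⟨N, fun n hn => ?_⟩
    have h1 : dist (f ∘L b.proj n) (g ∘L b.proj n) ≤ dist f g := by
      rw [dist_eq_norm, dist_eq_norm, ← ContinuousLinearMap.sub_comp]
      exact hle _ n
    have h2 := hN n hn
    have h3 := dist_triangle4 (f ∘L b.proj n) (g ∘L b.proj n) g f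
    rw [dist_comm g f] at h3
    linarith
  have htop : V = ⊤ := by
    refine hM.eq_top_of_norming V hclosed fun x C hC hx => ?_
    have hmem : ∀ (g : StrongDual 𝕜 X) (m : ℕ), g ∘L b.proj m ∈ V := by
      intro g m
      refine tendsto_const_nhds.congr' ?_
      filter_upwards [eventually_ge_atTop m] with n hn
      ext y
      simp only [ContinuousLinearMap.comp_apply, b.proj_comp, min_eq_left hn]
    obtain ⟨g, hg, hgx⟩ := exists_dual_vector'' 𝕜 x
    have hlim : Tendsto (fun n => ‖g (b.proj n x)‖) atTop (𝓝 ‖g x‖) :=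
      (g.continuous.norm.tendsto x).comp (b.tendsto_proj x)
    have hnorm : ‖g x‖ = ‖x‖ := by rw [hgx]; simp
    rw [← hnorm]
    refine le_of_tendsto' hlim fun n => (hx _ (hmem g n)).trans ?_
    exact mul_le_of_le_one_right hC ((hle g n).trans hg)
  have hf : f ∈ V := htop ▸ Submodule.mem_top
  exact hf

end MEmbedded

section CompactOperators

variable {𝕜 : Type*} [RCLike 𝕜] {X : Type*} [NormedAddCommGroup X] [NormedSpace 𝕜 X]
  {Z : Type*} [NormedAddCommGroup Z] [NormedSpace 𝕜 Z]

/-- If `f ∘ P n` tends to `f` for all functionals `f`, then `T ∘ P n` tends to `T` for all compact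
operators `T`. -/
theorem IsCompactOperator.tendsto_comp_of_tendsto_dual {T : X →L[𝕜] Z} (hT : IsCompactOperator T)
    {P : ℕ → X →L[𝕜] X} (hP : ∀ n, ‖P n‖ ≤ 1)
    (h : ∀ f : StrongDual 𝕜 X, Tendsto (fun n => f ∘L P n) atTop (𝓝 f)) :
    Tendsto (fun n => T ∘L P n) atTop (𝓝 T) := by
  by_contra hcon
  rw [Metric.tendsto_atTop] at hcon
  push Not at hcon
  obtain ⟨ε, hε, hfar⟩ := hcon
  have hx : ∀ n : ℕ, ∃ m ≥ n, ∃ x : X, ‖x‖ ≤ 1 ∧ ε / 2 ≤ ‖T (P m x - x)‖ := by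
    intro n
    obtain ⟨m, hm, hd⟩ := hfar n
    refine ⟨m, hm, ?_⟩
    by_contra! hc
    have : ‖T ∘L P m - T‖ ≤ ε / 2 := by
      refine ContinuousLinearMap.opNorm_le_of_unit_norm (by positivity) fun x hx => ?_
      have := (hc x hx.le).le
      rwa [map_sub] at this
    rw [dist_eq_norm] at hd
    linarith
  choose m hm x hx1 hxε using hx
  have hmt : Tendsto m atTop atTop := tendsto_atTop_mono hm tendsto_id
  have hball : ∀ n, T (P (m n) (x n) - x n) ∈ closure (T '' Metric.closedBall 0 2) := by
    refine fun n => subset_closure ⟨_, ?_, rfl⟩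
    rw [mem_closedBall_zero_iff]
    have h1 : ‖P (m n) (x n)‖ ≤ 1 :=
      ((P (m n)).le_of_opNorm_le_of_le (hP _) (hx1 n)).trans (by simp)
    exact (norm_sub_le _ _).trans (by linarith [hx1 n])
  obtain ⟨z, -, s, hs, hz⟩ := (hT.isCompact_closure_image_closedBall 2).tendsto_subseq hball
  have hz0 : z = 0 := by
    refine (SeparatingDual.eq_zero_iff_forall_dual_eq_zero (R := 𝕜) z).2 fun g => ?_
    have hl : Tendsto (fun n => g (T (P (m (s n)) (x (s n)) - x (s n)))) atTop (𝓝 (g z)) :=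
      (g.continuous.tendsto z).comp hz
    refine tendsto_nhds_unique hl (squeeze_zero_norm (a := fun n =>
      ‖(g ∘L T) ∘L P (m (s n)) - g ∘L T‖) (fun n => ?_) ?_)
    · have := ((g ∘L T) ∘L P (m (s n)) - g ∘L T).le_of_opNorm_le_of_le le_rfl (hx1 (s n))
      simpa using this
    · exact (tendsto_iff_norm_sub_tendsto_zero.1 (h (g ∘L T))).comp
        (hmt.comp hs.tendsto_atTop)
  have hge : ε / 2 ≤ ‖z‖ := ge_of_tendsto' hz.norm fun n => hxε (s n)
  rw [hz0, norm_zero] at hge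
  linarith

/-- The composition of an operator with a contractive projection of finite rank attains its
norm. -/
theorem attainsNorm_comp_of_finiteDimensional_range [Nontrivial X] (T : X →L[𝕜] Z)
    {P : X →L[𝕜] X} (hP : ‖P‖ ≤ 1) (hproj : ∀ x, P (P x) = P x)
    [FiniteDimensional 𝕜 P.toLinearMap.range] : AttainsNorm (T ∘L P) := by
  let F := P.toLinearMap.range
  have : ProperSpace F := FiniteDimensional.proper_rclike 𝕜 F
  obtain ⟨⟨_, u, rfl⟩, hy, hmax⟩ := (isCompact_closedBall (0 : F) 1).exists_isMaxOn
    ⟨0, by simp⟩ (f := fun y : F => ‖T y‖) (by fun_prop)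
  replace hy : ‖P u‖ ≤ 1 := by simpa using hy
  have hle : ‖T ∘L P‖ ≤ ‖T (P u)‖ := by
    refine ContinuousLinearMap.opNorm_le_of_unit_norm (norm_nonneg _) fun x hx => ?_
    refine hmax (a := (⟨P x, x, rfl⟩ : F)) ?_
    have : ‖P x‖ ≤ 1 := (P.le_of_opNorm_le_of_le hP hx.le).trans (by simp)
    simpa using this
  have hTu : (T ∘L P) (P u) = T (P u) := congrArg T (hproj u)
  have hge := (T ∘L P).le_opNorm (P u)
  rw [hTu] at hge
  rcases (norm_nonneg (T ∘L P)).eq_or_lt with h0 | hpos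
  · obtain ⟨x, hx⟩ := exists_ne (0 : X)
    have hx1 : ‖((‖x‖ : 𝕜)⁻¹) • x‖ = 1 := norm_smul_inv_norm hx
    refine ⟨_, hx1, le_antisymm ((T ∘L P).unit_le_opNorm _ hx1.le) ?_⟩
    rw [← h0]
    exact norm_nonneg _
  · refine ⟨P u, le_antisymm hy ?_, ?_⟩
    · exact le_of_mul_le_mul_left (by linarith) hpos
    · rw [hTu]
      exact le_antisymm (hge.trans (mul_le_of_le_one_right hpos.le hy)) hle

end CompactOperators

theorem mainTheorem8 {𝕜 : Type w} [RCLike 𝕜] {X : Type u} [NormedAddCommGroup X]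
    [NormedSpace 𝕜 X] [CompleteSpace X] (hM : IsMEmbedded 𝕜 X)
    (hb : ∃ b : SchauderBasis 𝕜 X, IsMonotoneBasis b) :
    PropertyAk.{w, u, v} 𝕜 X := by
  obtain ⟨b, hb⟩ := hb
  intro Z _ _ _ T hT
  have : Nontrivial X := ⟨b 0, 0, b.linearIndependent.ne_zero 0⟩
  refine mem_closure_of_tendsto (hT.tendsto_comp_of_tendsto_dual hb (hM.tendsto_comp_proj hb))
    (Eventually.of_forall fun n => ⟨hT.comp_clm (b.proj n), ?_⟩)
  have : FiniteDimensional 𝕜 (b.proj n).toLinearMap.range := by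
    rw [b.range_proj_eq_span]
    exact FiniteDimensional.span_of_finite 𝕜 (Set.toFinite _)
  exact attainsNorm_comp_of_finiteDimensional_range T (hb n) fun x => by
    rw [b.proj_comp, min_self]
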